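/- A \emph{ribbon graph} $G=(V,E)$ is a (compact) surface with boundary, represented as the union of two finite sets of closed discs, the set $V$ of vertices and the set $E$ of edges, such that distinct vertices are disjoint, distinct edges are disjoint, the vertices and edges intersect in disjoint line segments, each such segment lies on the boundary of precisely one vertex and precisely one edge, and every edge contains exactly two such segments. For $A\subseteq E$ let $(V,A)$ be the spanning ribbon subgraph formed by all the vertices and the edges in $A$. Let $k(G)$ be the number of connected components of $G$, and let $f(A)$ be the number of boundary components of the surface $(V,A)$. For an integer $n\ge 0$ define set systems on $E$ by $$D_{\le n}(G)=(E,\{A\subseteq E: f(A)\le k(G)+n\}),\qquad D_n(G)=(E,\{A\subseteq E: f(A)=k(G)+n\}),$$ and put $D(G)=D_0(G)$. For a set system $D=(E,\mathcal F)$ and $A\subseteq E$, the twist is $D*A=(E,\{A\triangle X: X\in\mathcal F\})$, and the dual is $D^*=D*E$. The \emph{partial dual} $G^A$ is obtained by gluing a disc to $G$ along each boundary component of $(V,A)$, regarded as a curve on the surface $G$, and removing the interiors of all the vertices of $G$; the new discs are the vertices of $G^A$, and its edges are the edges of $G$. The \emph{geometric dual} $G^*$ has as vertices a set of discs capping off the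 holes of $G$, one for each boundary component of $G$, and as edges the edges of $G$. \textbf{Theorem.} Let $G=(V,E)$ be a ribbon graph, $A\subseteq E$ and $k\ge 0$ an integer. Then $D_{\le k}(G^A)=D_{\le k}(G)*A$, and, in particular, $D(G^A)=D(G)*A$. If $G$ is orientable, then also $D_1(G^A)=D_1(G)*A$. Moreover, $D_{\le k}(G^*)=D_{\le k}(G)^*$, in particular $D(G^*)=D(G)^*$, and, if $G$ is orientable, $D_1(G^*)=D_1(G)^*$. -/

import Mathlib

open Topology unitInterval symmDiff

universe u v

/-! ### Set systems -/

/-- A set system on the ground set `E`: a collection of subsets of `E`, its feasible sets. -/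
@[ext]
structure SetSystem (E : Type v) where
  feasible : Set (Set E)

/-- The twist `D * A = (E, {A ∆ X | X feasible})`. -/
def SetSystem.twist {E : Type v} (D : SetSystem E) (A : Set E) : SetSystem E where
  feasible := {F | ∃ X ∈ D.feasible, F = A ∆ X}

/-- The dual `D* = D * E`. -/
def SetSystem.dual {E : Type v} (D : SetSystem E) : SetSystem E :=
  D.twist Set.univ

/-! ### Ribbon graphs -/

/-- The closed disc. -/
abbrev Disc : Type := Metric.closedBall (0 : ℂ) 1

/-- The boundary circle of the closed disc. -/
def Disc.circle : Set Disc := {z | ‖(z : ℂ)‖ = 1}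

/-- The interior of the closed disc. -/
def Disc.inner : Set Disc := {z | ‖(z : ℂ)‖ < 1}

/-- Edges are discs parametrised by the square `I × I`. The two end segments, `{0, 1} × I`. -/
def Square.ends : Set (I × I) := {p | p.1 = 0 ∨ p.1 = 1}

/-- The end segments without their end points. -/
def Square.openEnds : Set (I × I) := {p | (p.1 = 0 ∨ p.1 = 1) ∧ 0 < p.2 ∧ p.2 < 1}

/-- The two remaining sides of the square, `I × {0, 1}`. -/
def Square.sides : Set (I × I) := {p | p.2 = 0 ∨ p.2 = 1}

/-- The boundary circle of the square. -/
def Square.boundary : Set (I × I) := Square.ends ∪ Square.sides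

/-- A ribbon graph with edge set `E`: a space `X` that is the union of a finite family of
pairwise disjoint closed discs, the vertices, and a family of pairwise disjoint closed discs, the
edges. Each edge meets the vertices in exactly two disjoint line segments, its ends, and each end
lies on the boundary circle of one vertex (of exactly one, as the vertices are disjoint; and the
segments are disjoint, as the edges are). For finite `E` the space `X` is then
automatically a compact surface with boundary. -/
structure RibbonGraph (E : Type v) where
  /-- the underlying space of the surface -/
  X : Type u
  [top : TopologicalSpace X]
  [t2 : T2Space X]
  /-- the set of vertices -/
  V : Type u
  [finV : Finite V]
  /-- the vertex discs -/
  vert : V → Disc → X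
  /-- the edge discs -/
  edge : E → I × I → X
  vert_embedding : ∀ v, IsEmbedding (vert v)
  edge_embedding : ∀ e, IsEmbedding (edge e)
  cover : (⋃ v, Set.range (vert v)) ∪ (⋃ e, Set.range (edge e)) = Set.univ
  vert_disjoint : ∀ v w, v ≠ w → Disjoint (Set.range (vert v)) (Set.range (vert w))
  edge_disjoint : ∀ e f, e ≠ f → Disjoint (Set.range (edge e)) (Set.range (edge f))
  edge_inter : ∀ e, Set.range (edge e) ∩ (⋃ v, Set.range (vert v)) = edge e '' Square.ends
  attach : ∀ e (s : I), s = 0 ∨ s = 1 →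
    ∃ v, edge e '' {p | p.1 = s} ⊆ vert v '' Disc.circle

attribute [instance] RibbonGraph.top RibbonGraph.t2 RibbonGraph.finV

namespace RibbonGraph

variable {E : Type v}

/-- The union of the boundary circles of the vertices. -/
def vertexCircles (G : RibbonGraph.{u} E) : Set G.X :=
  ⋃ v, G.vert v '' Disc.circle

/-- The boundary of the surface: the part of the vertex circles to which no edge is attached,
together with the free sides of the edges. (The end points of an end segment are boundary points;
its other points are not.) -/
def boundary (G : RibbonGraph.{u} E) : Set G.X :=
  (G.vertexCircles \ ⋃ e, G.edge e '' Square.openEnds) ∪ ⋃ e, G.edge e '' Square.sides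

/-- `k(G)`, the number of connected components. -/
noncomputable def k (G : RibbonGraph.{u} E) : ℕ :=
  Nat.card (ConnectedComponents G.X)

/-- `f(G)`, the number of boundary components. -/
noncomputable def f (G : RibbonGraph.{u} E) : ℕ :=
  Nat.card (ConnectedComponents G.boundary)

/-- A surface is orientable if it contains no Möbius band, that is, no homeomorphic image of the
square with `(0, t)` and `(1, 1 - t)` identified. -/
def Orientable (G : RibbonGraph.{u} E) : Prop :=
  ¬ ∃ g : I × I → G.X, Continuous g ∧ ∀ p q, g p = g q ↔
    p = q ∨ (p.1 = 0 ∧ q.1 = 1 ∧ q.2 = σ p.2) ∨ (p.1 = 1 ∧ q.1 = 0 ∧ q.2 = σ p.2)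

/-- The part of the surface covered by the vertices and the edges in `A`. -/
def subsurface (G : RibbonGraph.{u} E) (A : Set E) : Set G.X :=
  (⋃ v, Set.range (G.vert v)) ∪ ⋃ e ∈ A, Set.range (G.edge e)

/-- The spanning ribbon subgraph `(V, A)`. -/
def spanning (G : RibbonGraph.{u} E) (A : Set E) : RibbonGraph.{u} A where
  X := G.subsurface A
  V := G.V
  vert v z := ⟨G.vert v z, Or.inl (Set.mem_iUnion.2 ⟨v, z, rfl⟩)⟩
  edge e p := ⟨G.edge e p, Or.inr (Set.mem_iUnion₂.2 ⟨e, e.2, p, rfl⟩)⟩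
  vert_embedding v := (G.vert_embedding v).codRestrict (G.subsurface A) _
  edge_embedding e := (G.edge_embedding e).codRestrict (G.subsurface A) _
  cover := by
    refine Set.eq_univ_of_forall ?_
    rintro ⟨x, hx⟩
    rcases hx with hx | hx
    · obtain ⟨v, z, rfl⟩ := Set.mem_iUnion.1 hx
      exact Or.inl (Set.mem_iUnion.2 ⟨v, z, rfl⟩)
    · obtain ⟨e, he, p, rfl⟩ := Set.mem_iUnion₂.1 hx
      exact Or.inr (Set.mem_iUnion.2 ⟨⟨e, he⟩, p, rfl⟩)
  vert_disjoint v w h := by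
    have := G.vert_disjoint v w h
    rw [Set.disjoint_left] at this ⊢
    rintro _ ⟨a, rfl⟩ ⟨b, hb⟩
    exact this ⟨a, rfl⟩ ⟨b, congrArg Subtype.val hb⟩
  edge_disjoint e e' h := by
    have := G.edge_disjoint e e' (fun h' => h (Subtype.ext h'))
    rw [Set.disjoint_left] at this ⊢
    rintro _ ⟨a, rfl⟩ ⟨b, hb⟩
    exact this ⟨a, rfl⟩ ⟨b, congrArg Subtype.val hb⟩
  edge_inter e := by
    have := Set.ext_iff.1 (G.edge_inter e)
    ext x
    constructor
    · rintro ⟨⟨p, rfl⟩, h⟩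
      obtain ⟨v, z, hz⟩ := Set.mem_iUnion.1 h
      obtain ⟨q, hq, h'⟩ := (this (G.edge e p)).1
        ⟨⟨p, rfl⟩, Set.mem_iUnion.2 ⟨v, z, congrArg Subtype.val hz⟩⟩
      exact ⟨q, hq, Subtype.ext h'⟩
    · rintro ⟨p, hp, rfl⟩
      obtain ⟨v, z, hz⟩ := Set.mem_iUnion.1 ((this (G.edge e p)).2 ⟨p, hp, rfl⟩).2
      exact ⟨⟨p, rfl⟩, Set.mem_iUnion.2 ⟨v, z, Subtype.ext hz⟩⟩
  attach e s hs := by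
    obtain ⟨v, hv⟩ := G.attach e s hs
    refine ⟨v, ?_⟩
    rintro _ ⟨p, hp, rfl⟩
    obtain ⟨z, hz, h⟩ := hv ⟨p, hp, rfl⟩
    exact ⟨z, hz, Subtype.ext h⟩

/-- `f(A)`, the number of boundary components of `(V, A)`. -/
noncomputable def fSub (G : RibbonGraph.{u} E) (A : Set E) : ℕ :=
  (G.spanning A).f

/-- The boundary components of `(V, A)` as curves on the surface of `G`. -/
def boundaryOn (G : RibbonGraph.{u} E) (A : Set E) : Set G.X :=
  (Subtype.val : G.subsurface A → G.X) '' (G.spanning A).boundary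

/-! ### The set systems of a ribbon graph -/

/-- `D_{≤ n}(G)`, with feasible sets the `A` such that `f(A) ≤ k(G) + n`. -/
noncomputable def spread (G : RibbonGraph.{u} E) (n : ℕ) : SetSystem E where
  feasible := {A | G.fSub A ≤ G.k + n}

/-- `D_n(G)`, with feasible sets the `A` such that `f(A) = k(G) + n`. -/
noncomputable def toggle (G : RibbonGraph.{u} E) (n : ℕ) : SetSystem E where
  feasible := {A | G.fSub A = G.k + n}

/-- `D(G) = D_0(G)`; its feasible sets are the edge sets of the spanning quasi-trees of `G`. -/
noncomputable def deltaMatroid (G : RibbonGraph.{u} E) : SetSystem E :=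
  G.toggle 0

/-! ### Partial duals and geometric duals -/

/-- `Y` is obtained from the surface `G` (embedded by `i`) by gluing one disc along each connected
component of the closed curve `C`, these discs being the vertices of `H` (embedded by `j`), and
the edges of `H` are the same discs in `Y` as those of `G`. The discs of `H` being
disjoint, their circles are the connected components of their union, so the equation
`circles` says that the discs are glued one along each component of `C`. -/
structure IsGluing (G H : RibbonGraph.{u} E) (C : Set G.X) {Y : Type u} [TopologicalSpace Y]
    (i : G.X → Y) (j : H.X → Y) : Prop where
  left_embedding : IsEmbedding i
  right_embedding : IsEmbedding j
  cover : Set.range i ∪ (⋃ w, j '' Set.range (H.vert w)) = Set.univ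
  inter : ∀ w, j '' Set.range (H.vert w) ∩ Set.range i = j '' (H.vert w '' Disc.circle)
  circles : j '' H.vertexCircles = i '' C
  edge_eq : ∀ e, j '' Set.range (H.edge e) = i '' Set.range (G.edge e)
  edge_boundary_eq : ∀ e, j '' (H.edge e '' Square.boundary) = i '' (G.edge e '' Square.boundary)

/-- `H` is the partial dual `G^A`: glue a disc to `G` along each boundary component of `(V, A)`
and remove the interiors of all the vertices of `G`; the discs are the vertices of `H`, and the
edges of `H` are those of `G`. -/
def IsPartialDual (G : RibbonGraph.{u} E) (A : Set E) (H : RibbonGraph.{u} E) : Prop :=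
  ∃ (Y : Type u) (_ : TopologicalSpace Y) (_ : T2Space Y) (i : G.X → Y) (j : H.X → Y),
    IsGluing G H (G.boundaryOn A) i j ∧
    Set.range j = (⋃ v, i '' (G.vert v '' Disc.inner))ᶜ

/-- `H` is the geometric dual `G*`: cap off the holes of `G` by discs, one for each
boundary component of `G`; then `H` consists of these discs, its vertices, and of the
edges of `G`. -/
def IsGeometricDual (G H : RibbonGraph.{u} E) : Prop :=
  ∃ (Y : Type u) (_ : TopologicalSpace Y) (_ : T2Space Y) (i : G.X → Y) (j : H.X → Y),
    IsGluing G H G.boundary i j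

end RibbonGraph

/-!
Fix an edge `e`. The boundary of `(V, B)` meets `e` in its two free sides if `e ∈ B` and in its two
end segments if `e ∉ B`; away from the edges it is the same curve for all `B`. Passing from `G` to
`G^A` keeps this last part, and exchanges the ends and the free sides of exactly the edges in `A`:
the discs of `G^A` are glued along the boundary of `(V, A)`, which fixes the new ends, and the new
sides are the closure of the rest of the boundary circle of the edge. Hence the boundary of the
spanning subgraph of `G^A` on `B` is the same curve as the boundary of the spanning subgraph of `G`
on `A ∆ B`.

Deleting the interiors of the vertices does not change the number of components, because vertex
circles are connected, and `G` and `G^A` coincide outside of these interiors; so `k(G^A) = k(G)`.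
As the boundary of `(V, E)` is the boundary of `G`, the geometric dual is the case `A = E`.
-/

/-! ### Embeddings and connected components -/

theorem exists_homeomorph_comp_eq_of_range_eq {X Y Z : Type*} [TopologicalSpace X]
    [TopologicalSpace Y] [TopologicalSpace Z] {f : X → Z} {g : Y → Z} (hf : IsEmbedding f)
    (hg : IsEmbedding g) (h : Set.range f = Set.range g) : ∃ φ : X ≃ₜ Y, g ∘ φ = f := by
  refine ⟨hf.toHomeomorph.trans ((Homeomorph.setCongr h).trans hg.toHomeomorph.symm), ?_⟩
  ext x
  exact congrArg Subtype.val
    (hg.toHomeomorph.apply_symm_apply (Homeomorph.setCongr h ⟨f x, x, rfl⟩))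

theorem card_connectedComponents_congr {X Y : Type*} [TopologicalSpace X] [TopologicalSpace Y]
    (h : X ≃ₜ Y) : Nat.card (ConnectedComponents X) = Nat.card (ConnectedComponents Y) :=
  Nat.card_congr (h.isQuotientMap.isCoinducing.connectedComponentsHomeomorph fun y => by
    rw [← h.image_symm, Set.image_singleton]
    exact isConnected_singleton).toEquiv

theorem card_connectedComponents_image {X Y : Type*} [TopologicalSpace X] [TopologicalSpace Y]
    {i : X → Y} (hi : IsEmbedding i) (S : Set X) :
    Nat.card (ConnectedComponents (i '' S)) = Nat.card (ConnectedComponents S) :=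
  (card_connectedComponents_congr (hi.homeomorphImage S)).symm

section ClosedCover

variable {X ι : Type*} [TopologicalSpace X] {Z : Set X} {P : ι → Set X}

theorem connectedComponents_mk_eq_of_isPreconnected_inter {S : Set X} (hS : IsPreconnected (S ∩ Z))
    {x y : Z} (hx : (x : X) ∈ S) (hy : (y : X) ∈ S) :
    ConnectedComponents.mk x = ConnectedComponents.mk y := by
  rw [ConnectedComponents.coe_eq_coe']
  have hpre : IsPreconnected ((↑) ⁻¹' S : Set Z) := by
    rwa [← IsInducing.subtypeVal.isPreconnected_image, Subtype.image_preimage_coe, Set.inter_comm]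
  exact hpre.subset_connectedComponent hy hx

theorem surjective_connectedComponentsMap_val_of_cover (cover : Z ∪ ⋃ a, P a = Set.univ)
    (conn : ∀ a, IsPreconnected (P a)) (ne : ∀ a, (P a ∩ Z).Nonempty) :
    Function.Surjective (continuous_subtype_val (p := (· ∈ Z))).connectedComponentsMap := by
  intro q
  obtain ⟨x, rfl⟩ := ConnectedComponents.surjective_coe q
  rcases cover.ge (Set.mem_univ x) with hx | hx
  · exact ⟨ConnectedComponents.mk ⟨x, hx⟩, rfl⟩
  · obtain ⟨a, ha⟩ := Set.mem_iUnion.1 hx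
    obtain ⟨z, hzP, hzZ⟩ := ne a
    exact ⟨ConnectedComponents.mk ⟨z, hzZ⟩,
      ConnectedComponents.coe_eq_coe'.2 ((conn a).subset_connectedComponent ha hzP)⟩

/-- `r` sends all of the piece `P a` to the component of `Z` that it meets. -/
theorem exists_continuous_retraction_connectedComponents (closedZ : IsClosed Z)
    (cover : Z ∪ ⋃ a, P a = Set.univ) (locFin : LocallyFinite P) (closed : ∀ a, IsClosed (P a))
    (conn : ∀ a, IsConnected (P a ∩ Z)) (inter : Pairwise fun a b => P a ∩ P b ⊆ Z) :
    ∃ r : X → ConnectedComponents Z, Continuous r ∧ ∀ z : Z, r z = ConnectedComponents.mk z := by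
  classical
  choose p hpP hpZ using fun a => (conn a).nonempty
  have exists_piece : ∀ x, x ∉ Z → ∃ a, x ∈ P a := fun x hx =>
    Set.mem_iUnion.1 ((cover.ge (Set.mem_univ x)).resolve_left hx)
  choose a ha using exists_piece
  let r (x : X) : ConnectedComponents Z :=
    ConnectedComponents.mk (if hx : x ∈ Z then ⟨x, hx⟩ else ⟨p (a x hx), hpZ _⟩)
  have r_eq_mk : ∀ z : Z, r z = ConnectedComponents.mk z := fun z =>
    congrArg ConnectedComponents.mk (dif_pos z.2)
  have r_eq_on_piece : ∀ b, ∀ x ∈ P b, r x = ConnectedComponents.mk ⟨p b, hpZ b⟩ := by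
    intro b x hxb
    by_cases hx : x ∈ Z
    · exact (r_eq_mk ⟨x, hx⟩).trans
        (connectedComponents_mk_eq_of_isPreconnected_inter (conn b).isPreconnected hxb (hpP b))
    · have hab : a x hx = b := by
        by_contra h
        exact hx (inter h ⟨ha x hx, hxb⟩)
      simp only [r, dif_neg hx, hab]
  have continuousOn_Z : ContinuousOn r Z := by
    rw [continuousOn_iff_continuous_domRestrict, show Z.domRestrict r = ConnectedComponents.mk from
      funext r_eq_mk]
    exact ConnectedComponents.continuous_coe
  have continuousOn_pieces : ContinuousOn r (⋃ b, P b) :=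
    locFin.continuousOn_iUnion closed fun b => continuousOn_const.congr (r_eq_on_piece b)
  refine ⟨r, ?_, r_eq_mk⟩
  rw [← continuousOn_univ, ← cover]
  exact continuousOn_Z.union_of_isClosed continuousOn_pieces closedZ (locFin.isClosed_iUnion closed)

theorem bijective_connectedComponentsMap_val_of_isClosed_cover (closedZ : IsClosed Z)
    (cover : Z ∪ ⋃ a, P a = Set.univ) (locFin : LocallyFinite P) (closed : ∀ a, IsClosed (P a))
    (conn : ∀ a, IsPreconnected (P a)) (connZ : ∀ a, IsConnected (P a ∩ Z))
    (inter : Pairwise fun a b => P a ∩ P b ⊆ Z) :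
    Function.Bijective (continuous_subtype_val (p := (· ∈ Z))).connectedComponentsMap := by
  refine ⟨?_, surjective_connectedComponentsMap_val_of_cover cover conn fun a => (connZ a).nonempty⟩
  obtain ⟨r, r_cont, r_eq⟩ :=
    exists_continuous_retraction_connectedComponents closedZ cover locFin closed connZ inter
  refine Function.LeftInverse.injective (g := r_cont.connectedComponentsLift) fun q => ?_
  obtain ⟨z, rfl⟩ := ConnectedComponents.surjective_coe q
  exact r_eq z

end ClosedCover

/-! ### The disc and the square -/

theorem Disc.isConnected_circle : IsConnected Disc.circle := by
  have image_val : (↑) '' Disc.circle = Metric.sphere (0 : ℂ) 1 := by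
    ext z
    simp only [Disc.circle, Set.mem_image, Set.mem_ofPred_eq, mem_sphere_zero_iff_norm]
    exact ⟨fun ⟨_, hw, hwz⟩ => hwz ▸ hw, fun hz => ⟨⟨z, by simp [hz]⟩, hz, rfl⟩⟩
  refine ⟨⟨⟨1, by simp⟩, by simp [Disc.circle]⟩, ?_⟩
  rw [← IsInducing.subtypeVal.isPreconnected_image, image_val]
  exact isPreconnected_sphere (by rw [Complex.rank_real_complex]; exact Nat.one_lt_ofNat) 0 1

theorem Disc.isClosed_circle : IsClosed Disc.circle :=
  isClosed_eq (by fun_prop) continuous_const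

instance Disc.instPreconnectedSpace : PreconnectedSpace Disc :=
  Subtype.preconnectedSpace (convex_closedBall (0 : ℂ) 1).isPreconnected

theorem Square.ends_eq_prod : Square.ends = {0, 1} ×ˢ Set.univ := by
  ext p
  simp [ends]

theorem Square.sides_eq_prod : Square.sides = Set.univ ×ˢ {0, 1} := by
  ext p
  simp [sides]

theorem Square.openEnds_eq : Square.openEnds = Square.ends \ Square.sides := by
  ext p
  simp only [openEnds, ends, sides, Set.mem_ofPred_eq, Set.mem_sdiff, not_or,
    unitInterval.pos_iff_ne_zero, unitInterval.lt_one_iff_ne_one]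

theorem closure_compl_endpoints_unitInterval : closure ({0, 1}ᶜ : Set I) = Set.univ := by
  rw [Set.compl_eq_univ_sdiff]
  exact (dense_univ.sdiff_finite (Set.toFinite _)).closure_eq

theorem Square.closure_boundary_sdiff_ends :
    closure (Square.boundary \ Square.ends) = Square.sides := by
  have prod_eq : Square.boundary \ Square.ends = {0, 1}ᶜ ×ˢ {0, 1} := by
    ext p
    simp [boundary, ends_eq_prod, sides_eq_prod, and_comm]
  rw [prod_eq, closure_prod_eq, closure_compl_endpoints_unitInterval,
    (Set.toFinite _).isClosed.closure_eq, sides_eq_prod]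

theorem Square.closure_boundary_sdiff_sides :
    closure (Square.boundary \ Square.sides) = Square.ends := by
  have prod_eq : Square.boundary \ Square.sides = {0, 1} ×ˢ {0, 1}ᶜ := by
    ext p
    simp [boundary, ends_eq_prod, sides_eq_prod]
  rw [prod_eq, closure_prod_eq, closure_compl_endpoints_unitInterval,
    (Set.toFinite _).isClosed.closure_eq, ends_eq_prod]

theorem SetSystem.mem_feasible_twist {E : Type v} {D : SetSystem E} {A F : Set E} :
    F ∈ (D.twist A).feasible ↔ A ∆ F ∈ D.feasible := by
  constructor
  · rintro ⟨X, hX, rfl⟩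
    rwa [symmDiff_symmDiff_cancel_left]
  · exact fun hF => ⟨A ∆ F, hF, (symmDiff_symmDiff_cancel_left A F).symm⟩

namespace RibbonGraph

variable {E : Type v}

/-! ### Boundary curves of spanning ribbon subgraphs -/

open Classical in
/-- The part of the boundary circle of the edge `e`, read in the square `I × I`, that belongs to the
boundary of `(V, B)`. -/
noncomputable def edgeArcs (B : Set E) (e : E) : Set (I × I) :=
  if e ∈ B then Square.sides else Square.ends

theorem edgeArcs_of_mem {B : Set E} {e : E} (he : e ∈ B) : edgeArcs B e = Square.sides :=
  if_pos he

theorem edgeArcs_of_notMem {B : Set E} {e : E} (he : e ∉ B) : edgeArcs B e = Square.ends :=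
  if_neg he

theorem edgeArcs_congr {B B' : Set E} {e : E} (h : e ∈ B ↔ e ∈ B') :
    edgeArcs B e = edgeArcs B' e :=
  open Classical in if_congr h rfl rfl

theorem closure_boundary_sdiff_edgeArcs (B : Set E) (e : E) :
    closure (Square.boundary \ edgeArcs B e) = edgeArcs Bᶜ e := by
  by_cases he : e ∈ B
  · rw [edgeArcs_of_mem he, edgeArcs_of_notMem (Set.notMem_compl_iff.2 he),
      Square.closure_boundary_sdiff_sides]
  · rw [edgeArcs_of_notMem he, edgeArcs_of_mem (Set.mem_compl he),
      Square.closure_boundary_sdiff_ends]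

theorem image_edgeArcs_of_image_ends {φ : (I × I) ≃ₜ (I × I)} {A : Set E} {e : E}
    (boundary : φ '' Square.boundary = Square.boundary)
    (ends : φ '' Square.ends = edgeArcs A e) (B : Set E) :
    φ '' edgeArcs B e = edgeArcs (A ∆ B) e := by
  by_cases he : e ∈ B
  · have iff_compl : e ∈ Aᶜ ↔ e ∈ A ∆ B := by simp [Set.mem_symmDiff, he]
    rw [edgeArcs_of_mem he, ← Square.closure_boundary_sdiff_ends, φ.image_closure,
      Set.image_sdiff φ.injective, boundary, ends, closure_boundary_sdiff_edgeArcs,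
      edgeArcs_congr iff_compl]
  · have iff_left : e ∈ A ↔ e ∈ A ∆ B := by simp [Set.mem_symmDiff, he]
    rw [edgeArcs_of_notMem he, ends, edgeArcs_congr iff_left]

section

variable (G : RibbonGraph.{u} E)

/-- The union of the edges. -/
def edgeUnion : Set G.X :=
  ⋃ e, Set.range (G.edge e)

/-- The surface without the interiors of the vertices. -/
def skeleton : Set G.X :=
  G.vertexCircles ∪ G.edgeUnion

theorem edge_mem_biUnion_image_iff {B : Set E} {S : Set (I × I)} {e : E} {p : I × I} :
    G.edge e p ∈ ⋃ f ∈ B, G.edge f '' S ↔ e ∈ B ∧ p ∈ S := by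
  simp only [Set.mem_iUnion, exists_prop]
  constructor
  · rintro ⟨f, hf, q, hq, hqp⟩
    obtain rfl : f = e := by
      by_contra hfe
      exact Set.disjoint_left.1 (G.edge_disjoint f e hfe) ⟨q, hqp⟩ ⟨p, rfl⟩
    exact ⟨hf, (G.edge_embedding f).injective hqp ▸ hq⟩
  · exact fun ⟨he, hp⟩ => ⟨e, he, p, hp, rfl⟩

theorem biUnion_image_subset_edgeUnion (B : Set E) (S : Set (I × I)) :
    ⋃ e ∈ B, G.edge e '' S ⊆ G.edgeUnion :=
  Set.iUnion₂_subset fun e _ =>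
    (Set.image_subset_range _ _).trans (Set.subset_iUnion (fun e => Set.range (G.edge e)) e)

theorem vertexCircles_subset : G.vertexCircles ⊆ ⋃ v, Set.range (G.vert v) :=
  Set.iUnion_mono fun _ => Set.image_subset_range _ _

theorem image_ends_subset_vertexCircles (e : E) : G.edge e '' Square.ends ⊆ G.vertexCircles := by
  rintro _ ⟨p, hp, rfl⟩
  obtain ⟨v, hv⟩ := G.attach e p.1 hp
  exact Set.mem_iUnion.2 ⟨v, hv ⟨p, rfl, rfl⟩⟩

theorem range_edge_inter_vertexCircles (e : E) :
    Set.range (G.edge e) ∩ G.vertexCircles = G.edge e '' Square.ends :=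
  subset_antisymm
    ((Set.inter_subset_inter_right _ G.vertexCircles_subset).trans (G.edge_inter e).subset)
    (Set.subset_inter (Set.image_subset_range _ _) (G.image_ends_subset_vertexCircles e))

theorem edge_mem_vertexCircles_iff {e : E} {p : I × I} :
    G.edge e p ∈ G.vertexCircles ↔ p ∈ Square.ends := by
  rw [← (G.edge_embedding e).injective.mem_set_image (s := Square.ends),
    ← G.range_edge_inter_vertexCircles]
  exact (and_iff_right (Set.mem_range_self p)).symm

/-- The inclusion of the surface `(V, B)` into `G`. -/
def spanningInclusion (B : Set E) : (G.spanning B).X → G.X :=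
  Subtype.val

theorem isEmbedding_spanningInclusion (B : Set E) : IsEmbedding (G.spanningInclusion B) :=
  IsEmbedding.subtypeVal

theorem boundaryOn_eq_image (B : Set E) :
    G.boundaryOn B = G.spanningInclusion B '' (G.spanning B).boundary :=
  rfl

theorem boundaryOn_eq_sdiff_union (B : Set E) :
    G.boundaryOn B = (G.vertexCircles \ ⋃ e ∈ B, G.edge e '' Square.openEnds) ∪
      ⋃ e ∈ B, G.edge e '' Square.sides := by
  have image_vertexCircles :
      G.spanningInclusion B '' (G.spanning B).vertexCircles = G.vertexCircles := by
    simp only [vertexCircles, Set.image_iUnion, Set.image_image]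
    rfl
  have image_edges : ∀ S : Set (I × I),
      G.spanningInclusion B '' (⋃ e, (G.spanning B).edge e '' S) = ⋃ e ∈ B, G.edge e '' S := by
    intro S
    simp only [Set.image_iUnion, Set.image_image, Set.biUnion_eq_iUnion]
    rfl
  rw [boundaryOn_eq_image, boundary, Set.image_union,
    Set.image_sdiff (G.isEmbedding_spanningInclusion B).injective, image_vertexCircles,
    image_edges, image_edges]

theorem boundaryOn_univ : G.boundaryOn Set.univ = G.boundary := by
  simp [boundaryOn_eq_sdiff_union, boundary]

theorem preimage_boundaryOn (B : Set E) (e : E) : G.edge e ⁻¹' G.boundaryOn B = edgeArcs B e := by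
  ext p
  rw [boundaryOn_eq_sdiff_union, Set.mem_preimage, Set.mem_union, Set.mem_sdiff,
    edge_mem_vertexCircles_iff, edge_mem_biUnion_image_iff, edge_mem_biUnion_image_iff,
    Square.openEnds_eq, Set.mem_sdiff]
  by_cases he : e ∈ B
  · simp only [edgeArcs_of_mem he, he, true_and]
    grind
  · simp only [edgeArcs_of_notMem he, he, false_and, not_false_eq_true, and_true, or_false]

theorem range_edge_inter_boundaryOn (B : Set E) (e : E) :
    Set.range (G.edge e) ∩ G.boundaryOn B = G.edge e '' edgeArcs B e := by
  rw [← preimage_boundaryOn, Set.image_preimage_eq_range_inter]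

theorem boundaryOn_sdiff_edgeUnion (B : Set E) :
    G.boundaryOn B \ G.edgeUnion = G.vertexCircles \ G.edgeUnion := by
  rw [boundaryOn_eq_sdiff_union, Set.union_sdiff_distrib, Set.sdiff_sdiff,
    Set.union_eq_right.2 (G.biUnion_image_subset_edgeUnion B _),
    Set.sdiff_eq_empty.2 (G.biUnion_image_subset_edgeUnion B _), Set.union_empty]

theorem boundaryOn_union_edgeUnion (B : Set E) : G.boundaryOn B ∪ G.edgeUnion = G.skeleton := by
  rw [← Set.sdiff_union_self, boundaryOn_sdiff_edgeUnion, Set.sdiff_union_self, skeleton]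

theorem boundaryOn_eq_sdiff_union_edgeArcs (B : Set E) :
    G.boundaryOn B = (G.vertexCircles \ G.edgeUnion) ∪ ⋃ e, G.edge e '' edgeArcs B e := by
  simp only [← range_edge_inter_boundaryOn, ← Set.iUnion_inter]
  rw [← boundaryOn_sdiff_edgeUnion (B := B), Set.inter_comm]
  exact (Set.sdiff_union_inter _ _).symm

theorem fSub_eq_card_boundaryOn (B : Set E) :
    G.fSub B = Nat.card (ConnectedComponents (G.boundaryOn B)) :=
  (card_connectedComponents_image (G.isEmbedding_spanningInclusion B) _).symm

/-! ### Components of a ribbon graph -/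

theorem range_vert_inter_vertexCircles (v : G.V) :
    Set.range (G.vert v) ∩ G.vertexCircles = G.vert v '' Disc.circle := by
  refine subset_antisymm ?_ (Set.subset_inter (Set.image_subset_range _ _)
    (Set.subset_iUnion (fun v => G.vert v '' Disc.circle) v))
  rintro x ⟨hxv, hx⟩
  obtain ⟨w, hxw⟩ := Set.mem_iUnion.1 hx
  obtain rfl : v = w := by
    by_contra hvw
    exact Set.disjoint_left.1 (G.vert_disjoint v w hvw) hxv (Set.image_subset_range _ _ hxw)
  exact hxw

theorem range_vert_inter_edgeUnion_subset (v : G.V) :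
    Set.range (G.vert v) ∩ G.edgeUnion ⊆ G.vertexCircles := by
  rintro x ⟨hxv, hx⟩
  obtain ⟨e, hxe⟩ := Set.mem_iUnion.1 hx
  exact G.image_ends_subset_vertexCircles e
    ((G.edge_inter e).subset ⟨hxe, Set.mem_iUnion.2 ⟨v, hxv⟩⟩)

theorem range_vert_inter_skeleton (v : G.V) :
    Set.range (G.vert v) ∩ G.skeleton = G.vert v '' Disc.circle := by
  rw [← range_vert_inter_vertexCircles, skeleton, Set.inter_union_distrib_left, Set.union_eq_left]
  exact Set.subset_inter Set.inter_subset_left (G.range_vert_inter_edgeUnion_subset v)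

theorem skeleton_union_vertices : G.skeleton ∪ ⋃ v, Set.range (G.vert v) = Set.univ :=
  Set.eq_univ_of_univ_subset <| G.cover.superset.trans <|
    Set.union_subset Set.subset_union_right (Set.subset_union_right.trans Set.subset_union_left)

theorem isClosed_skeleton [Finite E] : IsClosed G.skeleton :=
  (isClosed_iUnion_of_finite fun v =>
    (Disc.isClosed_circle.isCompact.image (G.vert_embedding v).continuous).isClosed).union
  (isClosed_iUnion_of_finite fun e => (isCompact_range (G.edge_embedding e).continuous).isClosed)

theorem card_connectedComponents_skeleton [Finite E] :
    Nat.card (ConnectedComponents G.skeleton) = G.k := by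
  refine Nat.card_eq_of_bijective _ (bijective_connectedComponentsMap_val_of_isClosed_cover
    G.isClosed_skeleton G.skeleton_union_vertices (locallyFinite_of_finite _)
    (fun v => (isCompact_range (G.vert_embedding v).continuous).isClosed)
    (fun v => isPreconnected_range (G.vert_embedding v).continuous) (fun v => ?_) fun v w hvw => ?_)
  · rw [range_vert_inter_skeleton]
    exact Disc.isConnected_circle.image _ (G.vert_embedding v).continuous.continuousOn
  · exact (G.vert_disjoint v w hvw).inter_eq.trans_subset (Set.empty_subset _)

end

/-! ### Gluings along the boundary of a spanning ribbon subgraph -/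

namespace IsGluing

variable {G H : RibbonGraph.{u} E} {C : Set G.X} {A : Set E} {Y : Type u} [TopologicalSpace Y]
  {i : G.X → Y} {j : H.X → Y}

theorem image_edgeUnion (h : IsGluing G H C i j) : j '' H.edgeUnion = i '' G.edgeUnion := by
  simp only [edgeUnion, Set.image_iUnion, h.edge_eq]

theorem image_skeleton (h : IsGluing G H (G.boundaryOn A) i j) :
    j '' H.skeleton = i '' G.skeleton := by
  rw [← G.boundaryOn_union_edgeUnion A, skeleton, Set.image_union, Set.image_union, h.circles,
    h.image_edgeUnion]

theorem image_vertexCircles_sdiff_edgeUnion (h : IsGluing G H (G.boundaryOn A) i j) :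
    j '' (H.vertexCircles \ H.edgeUnion) = i '' (G.vertexCircles \ G.edgeUnion) := by
  rw [← G.boundaryOn_sdiff_edgeUnion A, Set.image_sdiff h.right_embedding.injective,
    Set.image_sdiff h.left_embedding.injective, h.circles, h.image_edgeUnion]

theorem image_edge_ends (h : IsGluing G H (G.boundaryOn A) i j) (e : E) :
    j '' (H.edge e '' Square.ends) = i '' (G.edge e '' edgeArcs A e) := by
  rw [← range_edge_inter_vertexCircles, ← range_edge_inter_boundaryOn,
    Set.image_inter h.right_embedding.injective, Set.image_inter h.left_embedding.injective,
    h.edge_eq, h.circles]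

theorem exists_homeomorph_image_edge (h : IsGluing G H C i j) (e : E) :
    ∃ φ : (I × I) ≃ₜ (I × I), ∀ S, j '' (H.edge e '' S) = i '' (G.edge e '' (φ '' S)) := by
  obtain ⟨φ, hφ⟩ := exists_homeomorph_comp_eq_of_range_eq
    (h.right_embedding.comp (H.edge_embedding e)) (h.left_embedding.comp (G.edge_embedding e))
    (by rw [Set.range_comp, Set.range_comp, h.edge_eq])
  exact ⟨φ, fun S => by simp only [← Set.image_comp, ← Function.comp_assoc, hφ]⟩

theorem image_edge_edgeArcs (h : IsGluing G H (G.boundaryOn A) i j) (B : Set E) (e : E) :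
    j '' (H.edge e '' edgeArcs B e) = i '' (G.edge e '' edgeArcs (A ∆ B) e) := by
  obtain ⟨φ, hφ⟩ := h.exists_homeomorph_image_edge e
  have image_injective : Function.Injective fun S => i '' (G.edge e '' S) :=
    h.left_embedding.injective.image_injective.comp (G.edge_embedding e).injective.image_injective
  have boundary : φ '' Square.boundary = Square.boundary :=
    image_injective ((hφ _).symm.trans (h.edge_boundary_eq e))
  have ends : φ '' Square.ends = edgeArcs A e :=
    image_injective ((hφ _).symm.trans (h.image_edge_ends e))
  rw [hφ, image_edgeArcs_of_image_ends boundary ends]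

theorem image_boundaryOn (h : IsGluing G H (G.boundaryOn A) i j) (B : Set E) :
    j '' H.boundaryOn B = i '' G.boundaryOn (A ∆ B) := by
  simp only [boundaryOn_eq_sdiff_union_edgeArcs, Set.image_union, Set.image_iUnion,
    h.image_vertexCircles_sdiff_edgeUnion, h.image_edge_edgeArcs]

theorem fSub_eq (h : IsGluing G H (G.boundaryOn A) i j) (B : Set E) :
    H.fSub B = G.fSub (A ∆ B) := by
  rw [fSub_eq_card_boundaryOn, fSub_eq_card_boundaryOn,
    ← card_connectedComponents_image h.right_embedding, h.image_boundaryOn,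
    card_connectedComponents_image h.left_embedding]

theorem k_eq [Finite E] (h : IsGluing G H (G.boundaryOn A) i j) : H.k = G.k := by
  rw [← card_connectedComponents_skeleton, ← card_connectedComponents_skeleton,
    ← card_connectedComponents_image h.right_embedding, h.image_skeleton,
    card_connectedComponents_image h.left_embedding]

theorem spread_eq_twist [Finite E] (h : IsGluing G H (G.boundaryOn A) i j) (n : ℕ) :
    H.spread n = (G.spread n).twist A := by
  ext B
  rw [SetSystem.mem_feasible_twist]
  simp only [spread, Set.mem_ofPred_eq, h.fSub_eq, h.k_eq]

theorem toggle_eq_twist [Finite E] (h : IsGluing G H (G.boundaryOn A) i j) (n : ℕ) :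
    H.toggle n = (G.toggle n).twist A := by
  ext B
  rw [SetSystem.mem_feasible_twist]
  simp only [toggle, Set.mem_ofPred_eq, h.fSub_eq, h.k_eq]

end IsGluing

end RibbonGraph

theorem theoremt_general {E : Type v} [Finite E] (G : RibbonGraph.{u} E) :
    (∀ (A : Set E) (H : RibbonGraph.{u} E), G.IsPartialDual A H → ∀ n : ℕ,
      H.spread n = (G.spread n).twist A ∧ H.toggle n = (G.toggle n).twist A) ∧
    (∀ H : RibbonGraph.{u} E, G.IsGeometricDual H → ∀ n : ℕ,
      H.spread n = (G.spread n).dual ∧ H.toggle n = (G.toggle n).dual) := by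
  constructor
  · rintro A H ⟨Y, _, _, i, j, h, -⟩ n
    exact ⟨h.spread_eq_twist n, h.toggle_eq_twist n⟩
  · rintro H ⟨Y, _, _, i, j, h⟩ n
    rw [← G.boundaryOn_univ] at h
    exact ⟨h.spread_eq_twist n, h.toggle_eq_twist n⟩

theorem theoremt {E : Type v} [Finite E] (G : RibbonGraph.{u} E) :
    (∀ (A : Set E) (H : RibbonGraph.{u} E), G.IsPartialDual A H →
      (∀ k : ℕ, H.spread k = (G.spread k).twist A) ∧
      H.deltaMatroid = G.deltaMatroid.twist A ∧
      (G.Orientable → H.toggle 1 = (G.toggle 1).twist A)) ∧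
    (∀ H : RibbonGraph.{u} E, G.IsGeometricDual H →
      (∀ k : ℕ, H.spread k = (G.spread k).dual) ∧
      H.deltaMatroid = G.deltaMatroid.dual ∧
      (G.Orientable → H.toggle 1 = (G.toggle 1).dual)) :=
  ⟨fun A H h => have twist := (theoremt_general G).1 A H h
    ⟨fun k => (twist k).1, (twist 0).2, fun _ => (twist 1).2⟩,
  fun H h => have dual := (theoremt_general G).2 H h
    ⟨fun k => (dual k).1, (dual 0).2, fun _ => (dual 1).2⟩⟩
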